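/- Let $n,k\in\mathbb N$ and let $H\colon\mathbb R^{2n}\times\mathbb R^k\to\mathbb R$ be of class $C^{2,0}$, i.e. $H$ is continuous and has first and second partial Fréchet derivatives with respect to $x\in\mathbb R^{2n}$ that are continuous on $\mathbb R^{2n}\times\mathbb R^k$. Let $J=\begin{pmatrix}0&-I_n\\ I_n&0\end{pmatrix}$ and consider $$\dot x(t)=J\nabla_xH(x(t),\lambda),\qquad x(0)=x(2\pi).\qquad(\ast)$$ Let $H^1_{2\pi}$ be the Sobolev space of $2\pi$-periodic functions $x\in L^2$ with values in $\mathbb R^{2n}$ that have a weak derivative $\dot x\in L^2$, with inner product $\langle x,y\rangle_{L^2}+\langle\dot x,\dot y\rangle_{L^2}$. A solution of $(\ast)$ is a pair $(x,\lambda)\in H^1_{2\pi}\times\mathbb R^k$ satisfying the equation for almost every $t$. A solution is stationary if $x$ is constant; for $j\ge 1$ it is a $j$-solution if $2\pi/j$ is a (not necessarily minimal) period of $x$, i.e. if the isotropy group of $x$ for the action of $SO(2)$ on $H^1_{2\pi}$ by time translations contains the cyclic group $\mathbb Z_j$. Let $x_0\in\mathbb R^{2n}$ satisfy $\nabla_xH(x_0,\lambda)=0$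 for all $\lambda\in\mathbb R^k$, and identify $x_0$ with the constant function. The trivial solutions are the elements of $\{x_0\}\times\mathbb R^k$; all other solutions are nontrivial. For a set $X$ of nontrivial solutions, $(x_0,\lambda_0)$ is called a bifurcation point of solutions from $X$ if it is a cluster point of $X$ in $H^1_{2\pi}\times\mathbb R^k$. For a real symmetric $2n\times 2n$ matrix $K$ and $j\ge1$ put $$Q_0(K)=-K,\qquad Q_j(K)=\frac1{1+j^2}\begin{pmatrix}-K&jJ^t\\ jJ&-K\end{pmatrix},$$ and for $j\ge 0$ let $\Lambda_j=\{\lambda\in\mathbb R^k:\det Q_j(\nabla_x^2H(x_0,\lambda))=0\}$; let $\Lambda=\bigcup_{j\ge1}\Lambda_j$. Let $\lambda_0\in\mathbb R^k$. Then: (0) if $(x_0,\lambda_0)$ is a bifurcation point of nontrivial solutions of $(\ast)$, then $\lambda_0\in\Lambda_0\cup\Lambda$; (1) if $(x_0,\lambda_0)$ is a bifurcation point of nontrivial stationary solutions, then $\lambda_0\in\Lambda_0$; (2) for every $j\ge1$, if $(x_0,\lambda_0)$ is a bifurcation point of nonstationary $j$-solutions, then $\lambda_0\in\bigcup_{l\ge1}\Lambda_{lj}$.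 -/

import Mathlib

open MeasureTheory
open scoped ContDiff

noncomputable section

namespace HamBif

instance instTwoPiPos : Fact (0 < 2 * Real.pi) := ⟨Real.two_pi_pos⟩

/-- The circle `ℝ / 2πℤ`, carrying the measure of total mass `2π`. It is both the domain of the
`2π`-periodic functions and, through `φ ↦ (rotation by the angle φ)`, the group `SO(2)`. -/
abbrev Circ : Type := AddCircle (2 * Real.pi)

/-- The Euclidean phase space `ℝ²ⁿ`, the coordinates being split into two blocks of `n`. -/
abbrev Phase (n : ℕ) : Type := EuclideanSpace ℝ (Fin n ⊕ Fin n)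

/-- The Euclidean parameter space `ℝᵏ`. -/
abbrev Param (k : ℕ) : Type := EuclideanSpace ℝ (Fin k)

/-- The space `C^{2,0}(Y × P, ℝ)`: continuous functions with first and second partial Fréchet
derivatives with respect to the first variable which are continuous on `Y × P`. -/
structure IsC20 {Y P : Type*} [NormedAddCommGroup Y] [NormedSpace ℝ Y] [TopologicalSpace P]
    (H : Y × P → ℝ) : Prop where
  cont : Continuous H
  diff₁ : ∀ l : P, Differentiable ℝ (fun y => H (y, l))
  cont₁ : Continuous (fun p : Y × P => fderiv ℝ (fun y => H (y, p.2)) p.1)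
  diff₂ : ∀ l : P, Differentiable ℝ (fderiv ℝ (fun y => H (y, l)))
  cont₂ : Continuous (fun p : Y × P => fderiv ℝ (fderiv ℝ (fun y => H (y, p.2))) p.1)

/-- `∇ₓH(x, l)`. -/
def gradX {n k : ℕ} (H : Phase n × Param k → ℝ) (x : Phase n) (l : Param k) : Phase n :=
  gradient (fun y => H (y, l)) x

/-- The Hessian matrix `∇ₓ²H(x, l)` in the standard basis. -/
def hessX {n k : ℕ} (H : Phase n × Param k → ℝ) (x : Phase n) (l : Param k) :
    Matrix (Fin n ⊕ Fin n) (Fin n ⊕ Fin n) ℝ :=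
  Matrix.of fun a b =>
    fderiv ℝ (fderiv ℝ (fun y => H (y, l))) x
      (EuclideanSpace.single a 1) (EuclideanSpace.single b 1)

/-- The matrix `Q₀(K) = -K`. -/
def Q0 {n : ℕ} (K : Matrix (Fin n ⊕ Fin n) (Fin n ⊕ Fin n) ℝ) :
    Matrix (Fin n ⊕ Fin n) (Fin n ⊕ Fin n) ℝ :=
  -K

/-- The matrix `Q_j(K)`, used for `j ≥ 1`. Here `Matrix.J` is the block matrix `[0, -I; I, 0]`. -/
def Q {n : ℕ} (j : ℕ) (K : Matrix (Fin n ⊕ Fin n) (Fin n ⊕ Fin n) ℝ) :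
    Matrix ((Fin n ⊕ Fin n) ⊕ (Fin n ⊕ Fin n)) ((Fin n ⊕ Fin n) ⊕ (Fin n ⊕ Fin n)) ℝ :=
  (1 / (1 + (j : ℝ) ^ 2)) •
    Matrix.fromBlocks (-K) ((j : ℝ) • (Matrix.J (Fin n) ℝ).transpose)
      ((j : ℝ) • Matrix.J (Fin n) ℝ) (-K)

/-- `Λ₀(T)`. -/
def Lambda0 {n k : ℕ} (T : Param k → Matrix (Fin n ⊕ Fin n) (Fin n ⊕ Fin n) ℝ) :
    Set (Param k) :=
  {l | (Q0 (T l)).det = 0}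

/-- `Λ_j(T)`, used for `j ≥ 1`. -/
def LambdaJ {n k : ℕ} (j : ℕ) (T : Param k → Matrix (Fin n ⊕ Fin n) (Fin n ⊕ Fin n) ℝ) :
    Set (Param k) :=
  {l | (Q j (T l)).det = 0}

/-- `Λ(T)`, the union of the `Λ_j(T)` over the positive integers `j`. -/
def Lambda {n k : ℕ} (T : Param k → Matrix (Fin n ⊕ Fin n) (Fin n ⊕ Fin n) ℝ) :
    Set (Param k) :=
  ⋃ j : ℕ, ⋃ _ : 1 ≤ j, LambdaJ j T

/-- The space `L²` of `2π`-periodic functions with values in `ℝ²ⁿ`. -/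
abbrev L2 (n : ℕ) : Type := Lp (Phase n) 2 (volume : Measure Circ)

/-- `v` is the weak derivative of the `2π`-periodic function `u`: for all `2π`-periodic
`φ` of class `C^∞`, with derivative `ψ`, one has `∫ ⟨u, ψ⟩ = - ∫ ⟨v, φ⟩`. -/
def IsWeakDeriv {n : ℕ} (u v : L2 n) : Prop :=
  ∀ φ ψ : C(Circ, Phase n),
    ContDiff ℝ ∞ (fun t : ℝ => φ (t : Circ)) →
    (∀ t : ℝ, HasDerivAt (fun s : ℝ => φ (s : Circ)) (ψ (t : Circ)) t) →
    ∫ t : Circ, inner ℝ (u t) (ψ t) = - ∫ t : Circ, inner ℝ (v t) (φ t)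

theorem integrable_inner_cont {n : ℕ} (u : L2 n) (φ : C(Circ, Phase n)) :
    Integrable (fun t : Circ => (inner ℝ (u t) (φ t) : ℝ)) := by
  refine (L2.integrable_inner (𝕜 := ℝ) u (ContinuousMap.toLp 2 volume ℝ φ)).congr ?_
  filter_upwards [ContinuousMap.coeFn_toLp (p := 2) (𝕜 := ℝ) (volume : Measure Circ) φ] with t ht
  rw [ht]

theorem integral_inner_add {n : ℕ} (u v : L2 n) (φ : C(Circ, Phase n)) :
    ∫ t : Circ, (inner ℝ ((u + v) t) (φ t) : ℝ) =
      (∫ t : Circ, inner ℝ (u t) (φ t)) + ∫ t : Circ, inner ℝ (v t) (φ t) := by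
  rw [← integral_add (integrable_inner_cont u φ) (integrable_inner_cont v φ)]
  refine integral_congr_ae ?_
  filter_upwards [Lp.coeFn_add u v] with t ht
  rw [ht, Pi.add_apply, inner_add_left]

theorem integral_inner_smul {n : ℕ} (c : ℝ) (u : L2 n) (φ : C(Circ, Phase n)) :
    ∫ t : Circ, (inner ℝ ((c • u) t) (φ t) : ℝ) = c * ∫ t : Circ, inner ℝ (u t) (φ t) := by
  rw [← integral_const_mul]
  refine integral_congr_ae ?_
  filter_upwards [Lp.coeFn_smul c u] with t ht
  rw [ht, Pi.smul_apply, real_inner_smul_left]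

theorem integral_inner_zero {n : ℕ} (φ : C(Circ, Phase n)) :
    ∫ t : Circ, (inner ℝ ((0 : L2 n) t) (φ t) : ℝ) = 0 := by
  have h := integral_inner_smul 0 (0 : L2 n) φ
  rwa [zero_smul, zero_mul] at h

/-- The Sobolev space `H¹_{2π}` of `2π`-periodic functions with values in `ℝ²ⁿ`. An element is
a function in `L²` together with its (unique) weak derivative in `L²`, so the inner product
is `⟨x, y⟩_{L²} + ⟨ẋ, ẏ⟩_{L²}`. -/
def H1 (n : ℕ) : Submodule ℝ (WithLp 2 (L2 n × L2 n)) where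
  carrier := {x | IsWeakDeriv x.fst x.snd}
  zero_mem' := by
    intro φ ψ _ _
    exact (integral_inner_zero ψ).trans (by rw [← neg_zero, ← integral_inner_zero φ]; rfl)
  add_mem' := by
    intro x y hx hy φ ψ hφ hψ
    have h₁ := hx φ ψ hφ hψ
    have h₂ := hy φ ψ hφ hψ
    refine (integral_inner_add x.fst y.fst ψ).trans ?_
    rw [h₁, h₂, ← neg_add]
    exact congrArg Neg.neg (integral_inner_add x.snd y.snd φ).symm
  smul_mem' := by
    intro c x hx φ ψ hφ hψ
    have h₁ := hx φ ψ hφ hψ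
    refine (integral_inner_smul c x.fst ψ).trans ?_
    rw [h₁, mul_neg]
    exact congrArg Neg.neg (integral_inner_smul c x.snd φ).symm

/-- The element of `L²` underlying an element of `H¹_{2π}`. -/
def H1.val {n : ℕ} (x : H1 n) : L2 n := (x : WithLp 2 (L2 n × L2 n)).fst

/-- The weak derivative of an element of `H¹_{2π}`. -/
def H1.dot {n : ℕ} (x : H1 n) : L2 n := (x : WithLp 2 (L2 n × L2 n)).snd

theorem isWeakDeriv_const {n : ℕ} (c : Phase n) :
    IsWeakDeriv (Lp.const 2 (volume : Measure Circ) c) (0 : L2 n) := by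
  intro φ ψ hφ hψ
  rw [integral_inner_zero, neg_zero]
  have h₁ : ∫ t : Circ, (inner ℝ ((Lp.const 2 (volume : Measure Circ) c : L2 n) t) (ψ t) : ℝ)
      = ∫ t : Circ, (inner ℝ c (ψ t) : ℝ) := by
    refine integral_congr_ae ?_
    filter_upwards [Lp.coeFn_const (p := 2) (μ := (volume : Measure Circ)) c] with t ht
    rw [ht, Function.const_apply]
  rw [h₁, ← AddCircle.intervalIntegral_preimage (2 * Real.pi) 0
    (fun t : Circ => (inner ℝ c (ψ t) : ℝ))]
  have h₂ : ∀ t ∈ Set.uIcc (0 : ℝ) (0 + 2 * Real.pi),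
      HasDerivAt (fun s : ℝ => (inner ℝ c (φ (s : Circ)) : ℝ)) (inner ℝ c (ψ (t : Circ))) t := by
    intro t _
    simpa using (hasDerivAt_const t c).inner ℝ (hψ t)
  have h₃ : Continuous (fun t : ℝ => (inner ℝ c (ψ (t : Circ)) : ℝ)) :=
    continuous_const.inner (ψ.continuous.comp (AddCircle.continuous_mk' _))
  rw [intervalIntegral.integral_eq_sub_of_hasDerivAt h₂ (h₃.intervalIntegrable _ _),
    AddCircle.coe_add_period, sub_self]

/-- The constant function with value `c`, as an element of `H¹_{2π}`. -/
def constH1 {n : ℕ} (c : Phase n) : H1 n :=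
  ⟨WithLp.toLp 2 (Lp.const 2 (volume : Measure Circ) c, 0), isWeakDeriv_const c⟩

/-- The set of solutions `(x, l) ∈ H¹_{2π} × ℝᵏ` of `ẋ(t) = J ∇ₓH(x(t), l)`, `x(0) = x(2π)`:
the equation holds for almost every `t`, with the weak derivative of `x`. -/
def solutions {n k : ℕ} (H : Phase n × Param k → ℝ) : Set (H1 n × Param k) :=
  {p | ∀ᵐ t : Circ, H1.dot p.1 t =
    Matrix.toEuclideanLin (Matrix.J (Fin n) ℝ) (gradX H (H1.val p.1 t) p.2)}

/-- The set of trivial solutions `{x₀} × ℝᵏ`. -/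
def trivialSet {n : ℕ} (k : ℕ) (x₀ : Phase n) : Set (H1 n × Param k) :=
  {p | p.1 = constH1 x₀}

/-- The set of nontrivial solutions. -/
def nontrivialSolutions {n k : ℕ} (H : Phase n × Param k → ℝ) (x₀ : Phase n) :
    Set (H1 n × Param k) :=
  solutions H \ trivialSet k x₀

/-- `x` is stationary, that is, constant. -/
def IsStationary {n : ℕ} (x : H1 n) : Prop := ∃ c : Phase n, x = constH1 c

theorem ae_shift {p : Circ → Prop} (h : ∀ᵐ t : Circ, p t) (a : Circ) :
    ∀ᵐ t : Circ, p (t + a) :=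
  (measurePreserving_add_right (volume : Measure Circ) a).quasiMeasurePreserving.ae h

/-- The isotropy group of `x ∈ H¹_{2π}` for the action `(g x)(t) = x(t + φ)` of `SO(2)`, where
`g` is the rotation by the angle `φ`. -/
def isotropy {n : ℕ} (x : H1 n) : AddSubgroup Circ where
  carrier := {a | ∀ᵐ t : Circ, H1.val x (t + a) = H1.val x t}
  zero_mem' := by simp
  add_mem' := by
    intro a b ha hb
    change ∀ᵐ t : Circ, H1.val x (t + (a + b)) = H1.val x t
    filter_upwards [ae_shift hb a, ha] with t h₁ h₂
    rw [← add_assoc, h₁, h₂]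
  neg_mem' := by
    intro a ha
    change ∀ᵐ t : Circ, H1.val x (t + -a) = H1.val x t
    filter_upwards [ae_shift ha (-a)] with t h
    rw [← h, neg_add_cancel_right]

/-- The subgroup `𝕂_j` of `SO(2)`: the cyclic group of order `j` for `j ≥ 1`, and the whole
group `SO(2)` for `j = 0`. -/
def KK (j : ℕ) : AddSubgroup Circ where
  carrier := {a | j • a = 0}
  zero_mem' := by simp
  add_mem' := by
    intro a b ha hb
    change j • (a + b) = 0
    rw [nsmul_add, show j • a = 0 from ha, show j • b = 0 from hb, add_zero]
  neg_mem' := by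
    intro a ha
    change j • (-a) = 0
    rw [smul_neg, show j • a = 0 from ha, neg_zero]

/-- The set of `j`-solutions: solutions whose isotropy group contains `𝕂_j`. -/
def jSolutions {n k : ℕ} (H : Phase n × Param k → ℝ) (j : ℕ) : Set (H1 n × Param k) :=
  {p | p ∈ solutions H ∧ KK j ≤ isotropy p.1}

/-- `(x₀, l₀)` is a bifurcation point of solutions from a set `X` of nontrivial solutions:
it is a cluster point of `X` in `H¹_{2π} × ℝᵏ`. -/
def IsBifurcationPoint {n k : ℕ} (H : Phase n × Param k → ℝ) (x₀ : Phase n) (l₀ : Param k)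
    (X : Set (H1 n × Param k)) : Prop :=
  X ⊆ nontrivialSolutions H x₀ ∧ AccPt ((constH1 x₀, l₀) : H1 n × Param k) (Filter.principal X)

end HamBif

end

noncomputable section

namespace HamBif

/-! Each part is proved by contraposition: a nonresonant `l₀` has a neighbourhood without solutions
of the forbidden kind. Two isolation results carry this.

Stationary solutions (`exists_stationary_isolated`): if the Hessian `A` at `(x₀, l₀)` is invertible,
then `∇ₓH(·, l)` is injective near `x₀` for `l` near `l₀`, so `x₀` is its only zero there.

`j`-solutions (`exists_jSolutions_stationary`): let `c` be the mean of `x`, put `y = x - c` and `R =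
ẏ - J∇ₓH(c, l) - JAy`. The Sobolev inequality keeps `x(t)` near `x₀`, so continuity of the Hessian
and the mean value inequality give `‖R‖ ≤ (√κ/2) ‖y‖` in `L²`. The constant `J∇ₓH(c, l)` does not
contribute to harmonics `m ≠ 0`, and there `ẏ - JAy` is bounded below by `√κ`, uniformly in the
nonzero multiples `m` of `j` (`exists_harmonic_lower_bound`). The other harmonics of `y` vanish: `m
= 0` by the choice of `c`, those with `j ∤ m` by symmetry. Parseval gives `κ‖y‖² ≤ ‖R‖² ≤
(κ/4)‖y‖²`, so `y = 0` and `x` is constant.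

Since `c` is subtracted rather than `x₀`, the second result needs no condition on `Λ₀`. Statement
(0) combines both results, with `j = 1`. -/

/-! ### Weighted integrals and weak derivatives -/

theorem integrable_continuous_smul {n : ℕ} (w : C(Circ, ℝ)) (u : L2 n) :
    Integrable (fun t : Circ => w t • u t) := by
  have hu : Integrable (fun t : Circ => u t) := (Lp.memLp u).integrable one_le_two
  exact hu.bdd_smul (φ := fun t : Circ => w t) ‖w‖ w.continuous.aestronglyMeasurable
    (Filter.Eventually.of_forall fun t => w.norm_coe_le_norm t)

/-- The integral of `u ∈ L²` against a continuous scalar weight. -/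
def weightedInt {n : ℕ} (w : C(Circ, ℝ)) : L2 n →ₗ[ℝ] Phase n where
  toFun u := ∫ t : Circ, w t • u t
  map_add' u v := by
    rw [← integral_add (integrable_continuous_smul w u) (integrable_continuous_smul w v)]
    refine integral_congr_ae ?_
    filter_upwards [Lp.coeFn_add u v] with t ht
    rw [ht, Pi.add_apply, smul_add]
  map_smul' c u := by
    rw [RingHom.id_apply, ← integral_smul]
    refine integral_congr_ae ?_
    filter_upwards [Lp.coeFn_smul c u] with t ht
    rw [ht, Pi.smul_apply, smul_comm]

theorem weightedInt_apply {n : ℕ} (w : C(Circ, ℝ)) (u : L2 n) :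
    weightedInt w u = ∫ t : Circ, w t • u t := rfl

theorem integral_combination_smul {n : ℕ} (p q : ℝ) (w w' : C(Circ, ℝ)) (u : L2 n) :
    ∫ t : Circ, (p * w t + q * w' t) • u t = p • weightedInt w u + q • weightedInt w' u := by
  have h₁ : Integrable (fun t : Circ => p • w t • u t) := (integrable_continuous_smul w u).smul p
  have h₂ : Integrable (fun t : Circ => q • w' t • u t) := (integrable_continuous_smul w' u).smul q
  rw [weightedInt_apply, weightedInt_apply, ← integral_smul, ← integral_smul,
    ← integral_add h₁ h₂]
  simp only [add_smul, mul_smul]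

theorem weightedInt_compLp {n : ℕ} (w : C(Circ, ℝ)) (T : Phase n →L[ℝ] Phase n) (u : L2 n) :
    weightedInt w (T.compLp u) = T (weightedInt w u) := by
  rw [weightedInt_apply, weightedInt_apply,
    ← T.integral_comp_comm (integrable_continuous_smul w u)]
  refine integral_congr_ae ?_
  filter_upwards [T.coeFn_compLp u] with t ht
  rw [ht, map_smul]

theorem weightedInt_const {n : ℕ} (w : C(Circ, ℝ)) (c : Phase n) :
    weightedInt w (Lp.const 2 (volume : Measure Circ) c) = (∫ t : Circ, w t) • c := by
  rw [weightedInt_apply, ← integral_smul_const]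
  refine integral_congr_ae ?_
  filter_upwards [Lp.coeFn_const (p := 2) (μ := (volume : Measure Circ)) c] with t ht
  rw [ht, Function.const_apply]

theorem inner_weightedInt {n : ℕ} (w : C(Circ, ℝ)) (u : L2 n) (e : Phase n) :
    inner ℝ e (weightedInt w u) = ∫ t : Circ, inner ℝ (u t) (w t • e) := by
  rw [weightedInt_apply, ← integral_inner (integrable_continuous_smul w u)]
  refine integral_congr_ae (Filter.Eventually.of_forall fun t => ?_)
  simp only [real_inner_smul_right, real_inner_comm e]

/-- Testing the weak derivative against `w • e`, for each fixed vector `e`, determines the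
vector-valued integral. -/
theorem weightedInt_weakDeriv {n : ℕ} {u v : L2 n} (h : IsWeakDeriv u v) (w w' : C(Circ, ℝ))
    (hw : ContDiff ℝ ∞ (fun t : ℝ => w (t : Circ)))
    (hw' : ∀ t : ℝ, HasDerivAt (fun s : ℝ => w (s : Circ)) (w' (t : Circ)) t) :
    weightedInt w v = - weightedInt w' u := by
  refine ext_inner_left ℝ fun e => ?_
  rw [inner_neg_right, inner_weightedInt, inner_weightedInt]
  have := h (w • ContinuousMap.const Circ e) (w' • ContinuousMap.const Circ e)
    (hw.smul contDiff_const) (fun t => (hw' t).smul_const e)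
  simpa [neg_eq_iff_eq_neg] using congrArg Neg.neg this.symm

/-! ### Trigonometric coefficients -/

/-- `t ↦ cos (m t)` on the circle. -/
def cosC (m : ℤ) : C(Circ, ℝ) := ⟨fun t => (fourier m t).re, by fun_prop⟩

/-- `t ↦ sin (m t)` on the circle. -/
def sinC (m : ℤ) : C(Circ, ℝ) := ⟨fun t => (fourier m t).im, by fun_prop⟩

theorem fourier_coe_eq_exp (m : ℤ) (t : ℝ) :
    (fourier m (t : Circ) : ℂ) = Complex.exp (((m * t : ℝ) : ℂ) * Complex.I) := by
  rw [fourier_coe_apply]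
  congr 1
  have : (Real.pi : ℂ) ≠ 0 := by exact_mod_cast Real.pi_ne_zero
  push_cast
  field_simp

theorem cosC_coe (m : ℤ) (t : ℝ) : cosC m (t : Circ) = Real.cos (m * t) := by
  change (fourier m (t : Circ) : ℂ).re = _
  rw [fourier_coe_eq_exp, Complex.exp_ofReal_mul_I_re]

theorem sinC_coe (m : ℤ) (t : ℝ) : sinC m (t : Circ) = Real.sin (m * t) := by
  change (fourier m (t : Circ) : ℂ).im = _
  rw [fourier_coe_eq_exp, Complex.exp_ofReal_mul_I_im]

theorem integral_fourier {m : ℤ} (hm : m ≠ 0) : ∫ t : Circ, fourier m t = 0 := by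
  have h := congrFun (fourierCoeff_fourier (T := 2 * Real.pi) m) 0
  rw [Pi.single_eq_of_ne hm.symm, fourierCoeff, AddCircle.integral_haarAddCircle] at h
  simpa [Real.pi_ne_zero] using h

theorem integral_cosC {m : ℤ} (hm : m ≠ 0) : ∫ t : Circ, cosC m t = 0 := by
  have h := congrArg Complex.re (integral_fourier hm)
  rwa [← Complex.reCLM_apply, ← Complex.reCLM.integral_comp_comm
    ((fourier m).continuous.integrable_of_hasCompactSupport (.of_compactSpace _))] at h

theorem integral_sinC {m : ℤ} (hm : m ≠ 0) : ∫ t : Circ, sinC m t = 0 := by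
  have h := congrArg Complex.im (integral_fourier hm)
  rwa [← Complex.imCLM_apply, ← Complex.imCLM.integral_comp_comm
    ((fourier m).continuous.integrable_of_hasCompactSupport (.of_compactSpace _))] at h

/-- The cosine Fourier coefficients. -/
def cosCoeff {n : ℕ} (m : ℤ) : L2 n →ₗ[ℝ] Phase n := weightedInt (cosC m)

/-- The sine Fourier coefficients. -/
def sinCoeff {n : ℕ} (m : ℤ) : L2 n →ₗ[ℝ] Phase n := weightedInt (sinC m)

theorem cosCoeff_weakDeriv {n : ℕ} {u v : L2 n} (h : IsWeakDeriv u v) (m : ℤ) :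
    cosCoeff m v = (m : ℝ) • sinCoeff m u := by
  rw [cosCoeff, weightedInt_weakDeriv h (cosC m) (-(m : ℝ) • sinC m)]
  · simp only [sinCoeff, weightedInt_apply, ← integral_smul, ← integral_neg]
    simp [smul_smul]
  · simp only [cosC_coe]; fun_prop
  · intro t
    simp only [cosC_coe, ContinuousMap.smul_apply, sinC_coe, smul_eq_mul]
    convert (hasDerivAt_const_mul (m : ℝ)).cos using 1
    ring

theorem sinCoeff_weakDeriv {n : ℕ} {u v : L2 n} (h : IsWeakDeriv u v) (m : ℤ) :
    sinCoeff m v = -(m : ℝ) • cosCoeff m u := by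
  rw [sinCoeff, weightedInt_weakDeriv h (sinC m) ((m : ℝ) • cosC m)]
  · simp only [cosCoeff, weightedInt_apply, ← integral_smul, ← integral_neg]
    simp [smul_smul]
  · simp only [sinC_coe]; fun_prop
  · intro t
    simp only [cosC_coe, ContinuousMap.smul_apply, sinC_coe, smul_eq_mul]
    convert (hasDerivAt_const_mul (m : ℝ)).sin using 1
    ring

/-- Translation by `a` rotates the pair of coefficients by the angle `m * a`. An invariant pair is
fixed by this rotation, and a nontrivial rotation fixes only zero. -/
theorem coeff_eq_zero_of_shift {n : ℕ} (u : L2 n) (a : ℝ)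
    (ha : ∀ᵐ t : Circ, u (t + (a : Circ)) = u t) {m : ℤ} (hm : Real.cos (m * a) ≠ 1) :
    cosCoeff m u = 0 ∧ sinCoeff m u = 0 := by
  have key (w : C(Circ, ℝ)) : ∫ t : Circ, w (t + (a : Circ)) • u t = weightedInt w u := by
    rw [weightedInt_apply, ← integral_add_right_eq_self (fun t : Circ => w t • u t) (a : Circ)]
    refine integral_congr_ae ?_
    filter_upwards [ha] with t ht
    rw [ht]
  have hc : ∀ t : Circ, cosC m (t + (a : Circ)) =
      Real.cos (m * a) * cosC m t + -Real.sin (m * a) * sinC m t := by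
    intro t
    induction t using QuotientAddGroup.induction_on with
    | H t =>
      change cosC m ((t + a : ℝ) : Circ) = _ * cosC m (t : Circ) + _ * sinC m (t : Circ)
      rw [cosC_coe, cosC_coe, sinC_coe, mul_add, Real.cos_add]; ring
  have hs : ∀ t : Circ, sinC m (t + (a : Circ)) =
      Real.sin (m * a) * cosC m t + Real.cos (m * a) * sinC m t := by
    intro t
    induction t using QuotientAddGroup.induction_on with
    | H t =>
      change sinC m ((t + a : ℝ) : Circ) = _ * cosC m (t : Circ) + _ * sinC m (t : Circ)
      rw [sinC_coe, cosC_coe, sinC_coe, mul_add, Real.sin_add]; ring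
  have e₁ : cosCoeff m u = Real.cos (m * a) • cosCoeff m u + -Real.sin (m * a) • sinCoeff m u := by
    conv_lhs => rw [cosCoeff, ← key]
    simp only [hc, cosCoeff, sinCoeff, ← integral_combination_smul]
  have e₂ : sinCoeff m u = Real.sin (m * a) • cosCoeff m u + Real.cos (m * a) • sinCoeff m u := by
    conv_lhs => rw [sinCoeff, ← key]
    simp only [hs, cosCoeff, sinCoeff, ← integral_combination_smul]
  generalize cosCoeff m u = C at *
  generalize sinCoeff m u = S at *
  have h := Real.sin_sq_add_cos_sq (m * a)
  generalize Real.cos (m * a) = p at *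
  generalize Real.sin (m * a) = q at *
  -- `2 - 2p` is the determinant of identity minus rotation; the next two identities apply the
  -- adjugate.
  have hp : 2 - 2 * p ≠ 0 := fun h => hm (by linarith)
  have f₁ : (2 - 2 * p) • C = 0 := by
    have : (2 - 2 * p) • C = (1 - p) • (C - (p • C + -q • S)) - q • (S - (q • C + p • S))
        + (1 - (q ^ 2 + p ^ 2)) • C := by module
    rw [this, h, ← e₁, ← e₂]; simp
  have f₂ : (2 - 2 * p) • S = 0 := by
    have : (2 - 2 * p) • S = (1 - p) • (S - (q • C + p • S)) + q • (C - (p • C + -q • S))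
        + (1 - (q ^ 2 + p ^ 2)) • S := by module
    rw [this, h, ← e₁, ← e₂]; simp
  exact ⟨(smul_eq_zero.1 f₁).resolve_left hp, (smul_eq_zero.1 f₂).resolve_left hp⟩

/-! ### Parseval's identity for vector-valued functions -/

theorem norm_sq_eq_integral {n : ℕ} (u : L2 n) : ‖u‖ ^ 2 = ∫ t : Circ, ‖u t‖ ^ 2 := by
  rw [← real_inner_self_eq_norm_sq, L2.inner_def]
  simp only [real_inner_self_eq_norm_sq]

theorem memLp_coord {n : ℕ} (u : L2 n) (a : Fin n ⊕ Fin n) :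
    MemLp (fun t : Circ => ((u t a : ℝ) : ℂ)) 2 volume :=
  (Complex.ofRealCLM ∘L EuclideanSpace.proj a).comp_memLp u

/-- The complexified coordinates of an element of `L²`. -/
def coordLp {n : ℕ} (u : L2 n) (a : Fin n ⊕ Fin n) :
    Lp ℂ 2 (AddCircle.haarAddCircle (T := 2 * Real.pi)) :=
  (memLp_coord u a).haarAddCircle.toLp _

theorem coordLp_ae {n : ℕ} (u : L2 n) (a : Fin n ⊕ Fin n) :
    coordLp u a =ᵐ[AddCircle.haarAddCircle] fun t : Circ => ((u t a : ℝ) : ℂ) :=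
  MemLp.coeFn_toLp _

theorem ae_volume_of_ae_haar {p : Circ → Prop} (h : ∀ᵐ t ∂AddCircle.haarAddCircle, p t) :
    ∀ᵐ t : Circ, p t := by
  rw [AddCircle.volume_eq_smul_haarAddCircle]
  exact Measure.ae_smul_measure h _

theorem weightedInt_coord {n : ℕ} (w : C(Circ, ℝ)) (u : L2 n) (a : Fin n ⊕ Fin n) :
    weightedInt w u a = ∫ t : Circ, w t * u t a := by
  have := (EuclideanSpace.proj (𝕜 := ℝ) a).integral_comp_comm (integrable_continuous_smul w u)
  simpa [weightedInt_apply] using this.symm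

theorem integrable_mul_coord {n : ℕ} (w : C(Circ, ℝ)) (u : L2 n) (a : Fin n ⊕ Fin n) :
    Integrable (fun t : Circ => w t * u t a) := by
  simpa using (EuclideanSpace.proj (𝕜 := ℝ) a).integrable_comp (integrable_continuous_smul w u)

theorem fourierCoeff_coordLp {n : ℕ} (u : L2 n) (a : Fin n ⊕ Fin n) (m : ℤ) :
    fourierCoeff (coordLp u a) m = (((2 * Real.pi)⁻¹ : ℝ) : ℂ) *
      ((cosCoeff m u a : ℂ) - (sinCoeff m u a : ℂ) * Complex.I) := by
  rw [fourierCoeff_congr_ae (coordLp_ae u a), fourierCoeff, AddCircle.integral_haarAddCircle,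
    Complex.real_smul]
  congr 1
  rw [cosCoeff, sinCoeff, weightedInt_coord, weightedInt_coord, ← integral_complex_ofReal,
    ← integral_complex_ofReal, ← integral_mul_const, ← integral_sub]
  · refine integral_congr_ae (Filter.Eventually.of_forall fun t => ?_)
    simp only [smul_eq_mul, fourier_neg, Complex.ofReal_mul]
    rw [show (starRingEnd ℂ) (fourier m t) = (cosC m t : ℂ) - (sinC m t : ℂ) * Complex.I from
      Complex.ext (by simp [cosC]) (by simp [sinC])]
    ring
  · exact (integrable_mul_coord _ u a).ofReal
  · exact (integrable_mul_coord _ u a).ofReal.mul_const _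

theorem norm_sq_fourierCoeff_coordLp {n : ℕ} (u : L2 n) (a : Fin n ⊕ Fin n) (m : ℤ) :
    ‖fourierCoeff (coordLp u a) m‖ ^ 2 =
      (2 * Real.pi)⁻¹ ^ 2 * (cosCoeff m u a ^ 2 + sinCoeff m u a ^ 2) := by
  rw [fourierCoeff_coordLp, norm_mul, mul_pow, Complex.norm_real, Real.norm_eq_abs, sq_abs,
    Complex.sq_norm, Complex.normSq_apply]
  simp [sq]

/-- The squared size of the Fourier coefficients of index `m`. -/
def energy {n : ℕ} (m : ℤ) (u : L2 n) : ℝ := ‖cosCoeff m u‖ ^ 2 + ‖sinCoeff m u‖ ^ 2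

theorem energy_nonneg {n : ℕ} (m : ℤ) (u : L2 n) : 0 ≤ energy m u := by
  unfold energy; positivity

theorem energy_eq_sum {n : ℕ} (m : ℤ) (u : L2 n) :
    energy m u = ∑ a, (cosCoeff m u a ^ 2 + sinCoeff m u a ^ 2) := by
  simp [energy, EuclideanSpace.norm_sq_eq, Finset.sum_add_distrib]

/-- Scalar Parseval in each complexified coordinate, summed over coordinates. The coefficients are
not normalized, which costs `(2π)²`; passing from Haar probability measure to `volume` gives back
one factor. -/
theorem hasSum_energy {n : ℕ} (u : L2 n) :
    HasSum (fun m : ℤ => energy m u) (2 * Real.pi * ‖u‖ ^ 2) := by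
  have h (a : Fin n ⊕ Fin n) :
      HasSum (fun m : ℤ => cosCoeff m u a ^ 2 + sinCoeff m u a ^ 2)
        (2 * Real.pi * ∫ t : Circ, ‖u t a‖ ^ 2) := by
    have h₁ := (hasSum_sq_fourierCoeff (coordLp u a)).mul_left ((2 * Real.pi) ^ 2)
    have h₂ : ∫ t : Circ, ‖coordLp u a t‖ ^ 2 ∂AddCircle.haarAddCircle =
        (2 * Real.pi)⁻¹ * ∫ t : Circ, ‖u t a‖ ^ 2 := by
      refine Eq.trans ?_ (AddCircle.integral_haarAddCircle (f := fun t : Circ => ‖u t a‖ ^ 2))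
      refine integral_congr_ae ?_
      filter_upwards [coordLp_ae u a] with t ht
      rw [ht, Complex.norm_real]
    rw [h₂] at h₁
    have h₃ : (2 * Real.pi) ^ 2 * ((2 * Real.pi)⁻¹ * ∫ t : Circ, ‖u t a‖ ^ 2) =
        2 * Real.pi * ∫ t : Circ, ‖u t a‖ ^ 2 := by
      rw [← mul_assoc]; congr 1; field_simp
    rw [h₃] at h₁
    refine h₁.congr_fun fun m => ?_
    rw [norm_sq_fourierCoeff_coordLp]
    field_simp
  have hs := hasSum_sum (s := Finset.univ) fun a _ => h a
  convert hs using 1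
  · funext m; rw [energy_eq_sum]
  · rw [← Finset.mul_sum, norm_sq_eq_integral, ← integral_finsetSum]
    · simp only [EuclideanSpace.norm_sq_eq]
    · intro a _
      have := (memLp_coord u a).integrable_norm_pow two_ne_zero
      simpa using this

/-! ### The Sobolev inequality -/

/-- An absolutely summable Fourier series converges uniformly, and its continuous sum agrees almost
everywhere with the `L²` limit `f`. -/
theorem ae_norm_le_tsum_fourierCoeff (f : Lp ℂ 2 (AddCircle.haarAddCircle (T := 2 * Real.pi)))
    (hf : Summable fun m : ℤ => ‖fourierCoeff f m‖) :
    ∀ᵐ t : Circ, ‖f t‖ ≤ ∑' m : ℤ, ‖fourierCoeff f m‖ := by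
  have hn (m : ℤ) : ‖fourierCoeff f m • (fourier m : C(Circ, ℂ))‖ = ‖fourierCoeff f m‖ := by
    rw [norm_smul, fourier_norm, mul_one]
  have hs : Summable fun m : ℤ => fourierCoeff f m • (fourier m : C(Circ, ℂ)) :=
    Summable.of_norm (by simpa only [hn] using hf)
  have h₁ := hs.hasSum.mapL
    (ContinuousMap.toLp (E := ℂ) 2 (AddCircle.haarAddCircle (T := 2 * Real.pi)) ℂ)
  have h₂ := (hasSum_fourier_series_L2 f).unique (by simpa only [map_smul] using h₁)
  refine ae_volume_of_ae_haar ?_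
  filter_upwards [ContinuousMap.coeFn_toLp (p := 2) (𝕜 := ℂ)
    (AddCircle.haarAddCircle (T := 2 * Real.pi))
    (∑' m : ℤ, fourierCoeff f m • (fourier m : C(Circ, ℂ)))] with t ht
  rw [h₂, ht, ← h₂]
  refine (ContinuousMap.norm_coe_le_norm _ t).trans ?_
  refine (norm_tsum_le_tsum_norm (by simpa only [hn] using hf)).trans_eq ?_
  simp only [hn]

theorem energy_dot {n : ℕ} (x : H1 n) (m : ℤ) :
    energy m (H1.dot x) = (m : ℝ) ^ 2 * energy m (H1.val x) := by
  have hx : IsWeakDeriv (H1.val x) (H1.dot x) := x.2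
  rw [energy, cosCoeff_weakDeriv hx, sinCoeff_weakDeriv hx, energy, norm_smul, norm_smul,
    norm_neg, mul_pow, mul_pow, Real.norm_eq_abs, sq_abs]
  ring

theorem H1.norm_sq_eq {n : ℕ} (x : H1 n) : ‖x‖ ^ 2 = ‖H1.val x‖ ^ 2 + ‖H1.dot x‖ ^ 2 :=
  WithLp.prod_norm_sq_eq_of_L2 (x : WithLp 2 (L2 n × L2 n))

theorem hasSum_energy_H1 {n : ℕ} (x : H1 n) :
    HasSum (fun m : ℤ => (1 + (m : ℝ) ^ 2) * energy m (H1.val x)) (2 * Real.pi * ‖x‖ ^ 2) := by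
  convert (hasSum_energy (H1.val x)).add (hasSum_energy (H1.dot x)) using 1
  · funext m; rw [energy_dot]; ring
  · rw [H1.norm_sq_eq]; ring

theorem summable_inv_one_add_sq : Summable fun m : ℤ => (1 + (m : ℝ) ^ 2)⁻¹ := by
  refine Summable.of_norm_bounded_eventually
    (Real.summable_one_div_int_pow.2 (one_lt_two)) ?_
  rw [Filter.eventually_cofinite]
  refine (Set.finite_singleton (0 : ℤ)).subset fun m hm => ?_
  by_contra h0
  refine hm ?_
  have : 0 < (m : ℝ) ^ 2 := by
    have : (m : ℝ) ≠ 0 := by exact_mod_cast h0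
    positivity
  rw [Real.norm_of_nonneg (by positivity), one_div]
  gcongr
  linarith

/-- The Sobolev inequality: the supremum norm is bounded by the norm of `H¹`. -/
theorem exists_ae_norm_val_le (n : ℕ) :
    ∃ C : ℝ, 0 < C ∧ ∀ x : H1 n, ∀ᵐ t : Circ, ‖H1.val x t‖ ≤ C * ‖x‖ := by
  set W : ℝ := ∑' m : ℤ, (1 + (m : ℝ) ^ 2)⁻¹
  have hW : 0 ≤ W := tsum_nonneg fun m => by positivity
  set M : ℝ := (W + 2 * Real.pi) / 2
  have hM : 0 < M := by have := Real.pi_pos; positivity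
  -- The summand `1` keeps the constant positive when `n = 0`.
  refine ⟨Real.sqrt (Fintype.card (Fin n ⊕ Fin n)) * M + 1, by positivity, fun x => ?_⟩
  rcases (norm_nonneg x).eq_or_lt with hx | hx
  · have hx0 : x = 0 := norm_eq_zero.1 hx.symm
    subst hx0
    filter_upwards [Lp.coeFn_zero (Phase n) 2 (volume : Measure Circ)] with t ht
    have : H1.val (0 : H1 n) = 0 := rfl
    rw [this, ht]; simp
  have hcoord (a : Fin n ⊕ Fin n) : ∀ᵐ t : Circ, ‖H1.val x t a‖ ≤ M * ‖x‖ := by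
    -- Weighted AM-GM. Weights `‖x‖` and `‖x‖⁻¹` make both sums over `m` proportional to `‖x‖`; this
    -- is why `x = 0` was treated separately.
    have hle (m : ℤ) : ‖fourierCoeff (coordLp (H1.val x) a) m‖ ≤
        (‖x‖ * (1 + (m : ℝ) ^ 2)⁻¹ + ‖x‖⁻¹ * ((1 + (m : ℝ) ^ 2) * energy m (H1.val x))) / 2 := by
      have h₁ : ‖fourierCoeff (coordLp (H1.val x) a) m‖ ^ 2 ≤ energy m (H1.val x) := by
        rw [norm_sq_fourierCoeff_coordLp, energy_eq_sum]
        have h₂ : (2 * Real.pi)⁻¹ ^ 2 ≤ 1 := by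
          refine pow_le_one₀ (by have := Real.pi_pos; positivity) (inv_le_one_of_one_le₀ ?_)
          linarith [Real.pi_gt_three]
        refine (mul_le_of_le_one_left (by positivity) h₂).trans ?_
        exact Finset.single_le_sum (f := fun a => cosCoeff m (H1.val x) a ^ 2 +
          sinCoeff m (H1.val x) a ^ 2) (fun _ _ => by positivity) (Finset.mem_univ a)
      set p := ‖fourierCoeff (coordLp (H1.val x) a) m‖
      set q := 1 + (m : ℝ) ^ 2
      have hq : 0 < q := by positivity
      have h₂ : ‖x‖⁻¹ * (q * p ^ 2) ≤ ‖x‖⁻¹ * (q * energy m (H1.val x)) := by gcongr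
      have h₃ : 0 ≤ (‖x‖ * q⁻¹) * (‖x‖⁻¹ * (q * p) - 1) ^ 2 := by positivity
      have h₄ : (‖x‖ * q⁻¹) * (‖x‖⁻¹ * (q * p) - 1) ^ 2 =
          ‖x‖⁻¹ * (q * p ^ 2) - 2 * p + ‖x‖ * q⁻¹ := by
        field_simp; ring
      linarith
    have hsum := ((summable_inv_one_add_sq.hasSum.mul_left ‖x‖).add
      ((hasSum_energy_H1 x).mul_left ‖x‖⁻¹)).div_const 2
    have hs : Summable fun m : ℤ => ‖fourierCoeff (coordLp (H1.val x) a) m‖ :=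
      hsum.summable.of_nonneg_of_le (fun _ => norm_nonneg _) hle
    have hb : ∑' m : ℤ, ‖fourierCoeff (coordLp (H1.val x) a) m‖ ≤ M * ‖x‖ := by
      refine (hasSum_le hle hs.hasSum hsum).trans_eq ?_
      simp only [M]
      change (‖x‖ * W + ‖x‖⁻¹ * (2 * Real.pi * ‖x‖ ^ 2)) / 2 = _
      field_simp
    filter_upwards [ae_norm_le_tsum_fourierCoeff _ hs,
      ae_volume_of_ae_haar (coordLp_ae (H1.val x) a)] with t h₁ h₂
    rw [h₂, Complex.norm_real] at h₁
    exact h₁.trans hb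
  filter_upwards [ae_all_iff.2 hcoord] with t ht
  have h₁ : ‖H1.val x t‖ ≤ Real.sqrt (Fintype.card (Fin n ⊕ Fin n)) * (M * ‖x‖) := by
    refine abs_le_of_sq_le_sq' ?_ (by positivity) |>.2
    rw [EuclideanSpace.norm_sq_eq, mul_pow, Real.sq_sqrt (by positivity)]
    refine (Finset.sum_le_sum fun a _ => pow_le_pow_left₀ (norm_nonneg _) (ht a) 2).trans_eq ?_
    simp
  linarith [mul_assoc (Real.sqrt (Fintype.card (Fin n ⊕ Fin n))) M ‖x‖]

/-! ### Harmonics of the linearized equation -/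

/-- The hypotheses say that the harmonic with cosine and sine coefficients `c`, `s` solves `ẋ =
JKx`. Multiplying by `J` and using `J² = -1` puts `(c, s)` in the kernel of `Q j K`. -/
theorem eq_zero_of_det_Q_ne_zero {n : ℕ} {K : Matrix (Fin n ⊕ Fin n) (Fin n ⊕ Fin n) ℝ} {j : ℕ}
    (h : (Q j K).det ≠ 0) {c s : Fin n ⊕ Fin n → ℝ}
    (h₁ : (j : ℝ) • s = (Matrix.J (Fin n) ℝ).mulVec (K.mulVec c))
    (h₂ : -(j : ℝ) • c = (Matrix.J (Fin n) ℝ).mulVec (K.mulVec s)) : c = 0 ∧ s = 0 := by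
  have hJ (v : Fin n ⊕ Fin n → ℝ) :
      (Matrix.J (Fin n) ℝ).mulVec ((Matrix.J (Fin n) ℝ).mulVec v) = -v := by
    rw [Matrix.mulVec_mulVec, Matrix.J_squared, Matrix.neg_mulVec, Matrix.one_mulVec]
  have k₁ : K.mulVec c = -((j : ℝ) • (Matrix.J (Fin n) ℝ).mulVec s) := by
    rw [← Matrix.mulVec_smul, h₁, hJ, neg_neg]
  have k₂ : K.mulVec s = (j : ℝ) • (Matrix.J (Fin n) ℝ).mulVec c := by
    have := hJ (K.mulVec s)
    rw [← h₂, Matrix.mulVec_smul, neg_smul] at this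
    exact (neg_injective this).symm
  have hz : Sum.elim c s = 0 := by
    refine Matrix.eq_zero_of_mulVec_eq_zero h ?_
    rw [Q, Matrix.smul_mulVec, Matrix.fromBlocks_mulVec, Matrix.J_transpose]
    simp only [Sum.elim_comp_inl, Sum.elim_comp_inr, Matrix.neg_mulVec, Matrix.smul_mulVec,
      k₁, k₂, smul_neg, neg_neg, add_neg_cancel]
    ext i
    cases i <;> simp
  exact ⟨funext fun i => congrFun hz (Sum.inl i), funext fun i => congrFun hz (Sum.inr i)⟩

theorem eq_zero_of_det_Q_natAbs_ne_zero {n : ℕ}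
    {K : Matrix (Fin n ⊕ Fin n) (Fin n ⊕ Fin n) ℝ} {m : ℤ}
    (h : (Q m.natAbs K).det ≠ 0) {c s : Fin n ⊕ Fin n → ℝ}
    (h₁ : (m : ℝ) • s = (Matrix.J (Fin n) ℝ).mulVec (K.mulVec c))
    (h₂ : -(m : ℝ) • c = (Matrix.J (Fin n) ℝ).mulVec (K.mulVec s)) : c = 0 ∧ s = 0 := by
  obtain ⟨j, rfl | rfl⟩ := m.eq_nat_or_neg
  · exact eq_zero_of_det_Q_ne_zero (j := j) (by simpa using h) (by simpa using h₁)
      (by simpa using h₂)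
  -- Changing the sign of the index changes the sign of the sine coefficient only.
  · have := eq_zero_of_det_Q_ne_zero (j := j) (c := c) (s := -s) (by simpa using h)
      (by simpa using h₁) (by simp only [Matrix.mulVec_neg, ← h₂]; simp)
    simpa using this

/-- If no harmonic with index in `I` solves `ẋ = B x`, then `x ↦ ẋ - B x` is bounded below on the
harmonics with index in `I`, uniformly in the index. -/
theorem exists_harmonic_lower_bound {E : Type*} [NormedAddCommGroup E] [NormedSpace ℝ E]
    [FiniteDimensional ℝ E] (B : E →L[ℝ] E) (I : Set ℤ)
    (hI : ∀ m ∈ I, ∀ c s : E, (m : ℝ) • s = B c → -(m : ℝ) • c = B s → c = 0 ∧ s = 0) :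
    ∃ κ : ℝ, 0 < κ ∧ ∀ m ∈ I, ∀ c s : E,
      κ * (‖c‖ ^ 2 + ‖s‖ ^ 2) ≤ ‖(m : ℝ) • s - B c‖ ^ 2 + ‖-(m : ℝ) • c - B s‖ ^ 2 := by
  have hone (m : ℤ) (hm : m ∈ I) : ∃ κ₀ : ℝ, 0 < κ₀ ∧ ∀ c s : E,
      κ₀ * (‖c‖ ^ 2 + ‖s‖ ^ 2) ≤ ‖(m : ℝ) • s - B c‖ ^ 2 + ‖-(m : ℝ) • c - B s‖ ^ 2 := by
    let T : E × E →ₗ[ℝ] E × E :=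
      ((m : ℝ) • LinearMap.snd ℝ E E - B.toLinearMap ∘ₗ LinearMap.fst ℝ E E).prod
        (-(m : ℝ) • LinearMap.fst ℝ E E - B.toLinearMap ∘ₗ LinearMap.snd ℝ E E)
    have hT (c s : E) : T (c, s) = ((m : ℝ) • s - B c, -(m : ℝ) • c - B s) := rfl
    have hker : LinearMap.ker T = ⊥ := by
      rw [LinearMap.ker_eq_bot']
      rintro ⟨c, s⟩ h
      rw [hT, Prod.mk_eq_zero, sub_eq_zero, sub_eq_zero] at h
      rw [Prod.mk_eq_zero]
      exact hI m hm c s h.1 h.2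
    obtain ⟨K, hK, hTK⟩ := T.exists_antilipschitzWith hker
    have hK' : (0 : ℝ) < K := hK
    refine ⟨(2 * (K : ℝ) ^ 2)⁻¹, by positivity, fun c s => ?_⟩
    have h := hTK.le_mul_dist (c, s) 0
    rw [map_zero, dist_zero_right, dist_zero_right, hT] at h
    set p := (m : ℝ) • s - B c
    set q := -(m : ℝ) • c - B s
    have h₁ : ‖c‖ ≤ K * ‖(p, q)‖ := (norm_fst_le (c, s)).trans h
    have h₂ : ‖s‖ ≤ K * ‖(p, q)‖ := (norm_snd_le (c, s)).trans h
    have h₃ : ‖(p, q)‖ ^ 2 ≤ ‖p‖ ^ 2 + ‖q‖ ^ 2 := by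
      rw [Prod.norm_mk]
      rcases max_choice ‖p‖ ‖q‖ with h | h <;> rw [h] <;> nlinarith [norm_nonneg p, norm_nonneg q]
    have h₄ : ‖c‖ ^ 2 ≤ (K * ‖(p, q)‖) ^ 2 := by gcongr
    have h₅ : ‖s‖ ^ 2 ≤ (K * ‖(p, q)‖) ^ 2 := by gcongr
    rw [inv_mul_le_iff₀ (by positivity)]
    have h₆ := mul_le_mul_of_nonneg_left h₃ (sq_nonneg (K : ℝ))
    linarith [mul_pow (K : ℝ) ‖(p, q)‖ 2]
  have hone' (m : ℤ) : ∀ᶠ κ : ℝ in nhdsWithin 0 (Set.Ioi 0), m ∈ I → ∀ c s : E,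
      κ * (‖c‖ ^ 2 + ‖s‖ ^ 2) ≤ ‖(m : ℝ) • s - B c‖ ^ 2 + ‖-(m : ℝ) • c - B s‖ ^ 2 := by
    by_cases hm : m ∈ I
    · obtain ⟨κ₀, h₀, h⟩ := hone m hm
      filter_upwards [Ioo_mem_nhdsGT h₀] with κ hκ _ c s
      exact (mul_le_mul_of_nonneg_right hκ.2.le (by positivity)).trans (h c s)
    · exact Filter.Eventually.of_forall fun κ h => absurd h hm
  -- Beyond `N` the term with factor `m` dominates `B`, and any `κ ≤ 1/2` works.
  obtain ⟨N, hN⟩ := exists_nat_ge (‖B‖ + 1)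
  have hfin := (Set.finite_Icc (-(N : ℤ)) N).eventually_all.2 fun m _ => hone' m
  obtain ⟨κ, hκ, hpos, hlt⟩ :=
    (hfin.and (Ioo_mem_nhdsGT (show (0 : ℝ) < 1 / 2 by norm_num))).exists
  refine ⟨κ, hpos, fun m hm c s => ?_⟩
  by_cases hmN : m ∈ Set.Icc (-(N : ℤ)) N
  · exact hκ m hmN hm c s
  have habs : ‖B‖ + 1 ≤ ‖(m : ℝ)‖ := by
    refine hN.trans ?_
    have : (N : ℤ) ≤ |m| := by
      rw [Set.mem_Icc, ← abs_le, not_le] at hmN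
      exact hmN.le
    rw [Real.norm_eq_abs]
    exact_mod_cast this
  have h₁ : ‖(m : ℝ)‖ * ‖s‖ - ‖B‖ * ‖c‖ ≤ ‖(m : ℝ) • s - B c‖ := by
    have := norm_sub_norm_le ((m : ℝ) • s) (B c)
    rw [norm_smul] at this
    linarith [B.le_opNorm c]
  have h₂ : ‖(m : ℝ)‖ * ‖c‖ - ‖B‖ * ‖s‖ ≤ ‖-(m : ℝ) • c - B s‖ := by
    have := norm_sub_norm_le (-(m : ℝ) • c) (B s)
    rw [norm_smul, norm_neg] at this
    linarith [B.le_opNorm s]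
  have h₃ : ‖c‖ + ‖s‖ ≤ ‖(m : ℝ) • s - B c‖ + ‖-(m : ℝ) • c - B s‖ := by
    have := mul_le_mul_of_nonneg_right habs (add_nonneg (norm_nonneg c) (norm_nonneg s))
    linarith
  have h₄ := mul_le_mul_of_nonneg_right hlt.le (add_nonneg (sq_nonneg ‖c‖) (sq_nonneg ‖s‖))
  have h₅ : (‖c‖ + ‖s‖) ^ 2 ≤ (‖(m : ℝ) • s - B c‖ + ‖-(m : ℝ) • c - B s‖) ^ 2 := by gcongr
  nlinarith [sq_nonneg (‖(m : ℝ) • s - B c‖ - ‖-(m : ℝ) • c - B s‖),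
    mul_nonneg (norm_nonneg c) (norm_nonneg s)]

/-! ### The Hessian operator and linear approximation of the gradient -/

/-- The Hessian `∇ₓ²H(x, l)` as an operator. -/
def hessOp {n k : ℕ} (H : Phase n × Param k → ℝ) (x : Phase n) (l : Param k) :
    Phase n →L[ℝ] Phase n :=
  (InnerProductSpace.toDual ℝ (Phase n)).symm.toContinuousLinearEquiv.toContinuousLinearMap ∘L
    fderiv ℝ (fderiv ℝ (fun y => H (y, l))) x

theorem inner_hessOp {n k : ℕ} (H : Phase n × Param k → ℝ) (x : Phase n) (l : Param k)
    (v w : Phase n) :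
    inner ℝ (hessOp H x l v) w = fderiv ℝ (fderiv ℝ (fun y => H (y, l))) x v w :=
  InnerProductSpace.toDual_symm_apply

theorem hessOp_apply {n k : ℕ} {H : Phase n × Param k → ℝ} (hH : IsC20 H) (x : Phase n)
    (l : Param k) (v : Phase n) :
    hessOp H x l v = Matrix.toEuclideanLin (hessX H x l) v := by
  -- `hessOp` puts `v` in the first slot, while the matrix product puts it in the second.
  have hsymm (v w : Phase n) : fderiv ℝ (fderiv ℝ (fun y => H (y, l))) x v w =
      fderiv ℝ (fderiv ℝ (fun y => H (y, l))) x w v :=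
    second_derivative_symmetric (fun y => (hH.diff₁ l y).hasFDerivAt)
      (hH.diff₂ l x).hasFDerivAt v w
  ext a
  have h₁ : hessOp H x l v a = inner ℝ (hessOp H x l v) (EuclideanSpace.single a 1) := by
    rw [EuclideanSpace.inner_single_right]; simp
  rw [h₁, inner_hessOp, hsymm]
  conv_lhs => rw [← (EuclideanSpace.basisFun (Fin n ⊕ Fin n) ℝ).sum_repr v]
  simp only [map_sum, map_smul, Matrix.toLpLin_apply, Matrix.mulVec, dotProduct, hessX,
    Matrix.of_apply]
  refine Finset.sum_congr rfl fun b _ => ?_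
  simp [mul_comm]

theorem exists_norm_sub_lt_of_continuous {X F : Type*} [PseudoMetricSpace X]
    [NormedAddCommGroup F] {G : X → F} (hG : Continuous G) (x : X) {ε : ℝ} (hε : 0 < ε) :
    ∃ δ : ℝ, 0 < δ ∧ ∀ y : X, dist y x < δ → ‖G y - G x‖ < ε := by
  simpa only [dist_eq_norm] using Metric.continuous_iff.1 hG x ε hε

/-- Mean value inequality on a convex ball where all Hessians are `ε`-close to the one at `(x₀,
l₀)`. Both base points are free: `y` is later `x₀` for stationary solutions and the mean value for
`j`-solutions. -/
theorem exists_gradX_remainder_le {n k : ℕ} {H : Phase n × Param k → ℝ} (hH : IsC20 H)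
    (x₀ : Phase n) (l₀ : Param k) {ε : ℝ} (hε : 0 < ε) :
    ∃ δ : ℝ, 0 < δ ∧ ∀ l ∈ Metric.ball l₀ δ, ∀ x ∈ Metric.ball x₀ δ, ∀ y ∈ Metric.ball x₀ δ,
      ‖gradX H x l - gradX H y l - hessOp H x₀ l₀ (x - y)‖ ≤ ε * ‖x - y‖ := by
  obtain ⟨δ, hδ, h⟩ := exists_norm_sub_lt_of_continuous
    (F := Phase n →L[ℝ] Phase n →L[ℝ] ℝ) hH.cont₂ (x₀, l₀) hε
  refine ⟨δ, hδ, fun l hl x hx y hy => ?_⟩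
  have hb : ∀ z ∈ Metric.ball x₀ δ, ‖fderiv ℝ (fderiv ℝ (fun y => H (y, l))) z -
      fderiv ℝ (fderiv ℝ (fun y => H (y, l₀))) x₀‖ ≤ ε := by
    intro z hz
    have hzl : dist (z, l) (x₀, l₀) < δ := max_lt hz hl
    exact (h (z, l) hzl).le
  have := (convex_ball x₀ δ).norm_image_sub_le_of_norm_hasFDerivWithin_le'
    (fun z _ => (hH.diff₂ l z).hasFDerivAt.hasFDerivWithinAt) hb hy hx
  rw [← (InnerProductSpace.toDual ℝ (Phase n)).symm.norm_map, map_sub, map_sub] at this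
  exact this

/-- The operator of multiplication by `J`. -/
def JOp (n : ℕ) : Phase n →L[ℝ] Phase n :=
  LinearMap.toContinuousLinearMap (Matrix.toEuclideanLin (Matrix.J (Fin n) ℝ))

theorem JOp_apply {n : ℕ} (v : Phase n) :
    JOp n v = Matrix.toEuclideanLin (Matrix.J (Fin n) ℝ) v := rfl

theorem JOp_JOp {n : ℕ} (v : Phase n) : JOp n (JOp n v) = -v := by
  rw [JOp_apply, JOp_apply, Matrix.toLpLin_apply, Matrix.toLpLin_apply]
  simp [Matrix.mulVec_mulVec, Matrix.J_squared, Matrix.neg_mulVec]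

theorem eq_zero_of_JOp_eq_zero {n : ℕ} {v : Phase n} (h : JOp n v = 0) : v = 0 := by
  rw [← neg_eq_zero, ← JOp_JOp, h, map_zero]

theorem harmonic_eq_zero {n k : ℕ} {H : Phase n × Param k → ℝ} (hH : IsC20 H) {x : Phase n}
    {l : Param k} {m : ℤ} (hm : (Q m.natAbs (hessX H x l)).det ≠ 0) {c s : Phase n}
    (h₁ : (m : ℝ) • s = (JOp n ∘L hessOp H x l) c)
    (h₂ : -(m : ℝ) • c = (JOp n ∘L hessOp H x l) s) : c = 0 ∧ s = 0 := by
  rw [ContinuousLinearMap.comp_apply, hessOp_apply hH, JOp_apply, Matrix.toLpLin_apply,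
    Matrix.toLpLin_apply] at h₁ h₂
  have h := eq_zero_of_det_Q_natAbs_ne_zero hm (c := c.ofLp) (s := s.ofLp)
    (by simpa using congrArg WithLp.ofLp h₁) (by simpa using congrArg WithLp.ofLp h₂)
  exact ⟨WithLp.ofLp_injective 2 h.1, WithLp.ofLp_injective 2 h.2⟩

theorem exists_norm_le_hessOp {n k : ℕ} {H : Phase n × Param k → ℝ} (hH : IsC20 H) {x : Phase n}
    {l : Param k} (h : (Q0 (hessX H x l)).det ≠ 0) :
    ∃ κ : ℝ, 0 < κ ∧ ∀ v : Phase n, ‖v‖ ≤ κ * ‖hessOp H x l v‖ := by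
  have hker : LinearMap.ker (hessOp H x l).toLinearMap = ⊥ := by
    rw [LinearMap.ker_eq_bot']
    intro v hv
    have hv' : hessOp H x l v = 0 := hv
    rw [hessOp_apply hH, Matrix.toLpLin_apply] at hv'
    refine WithLp.ofLp_injective 2 (Matrix.eq_zero_of_mulVec_eq_zero h ?_)
    rw [Q0, Matrix.neg_mulVec, neg_eq_zero]
    simpa using congrArg WithLp.ofLp hv'
  obtain ⟨κ, hκ, hT⟩ := LinearMap.exists_antilipschitzWith _ hker
  refine ⟨κ, hκ, fun v => ?_⟩
  have := hT.le_mul_dist v 0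
  rwa [map_zero, dist_zero_right, dist_zero_right] at this

/-! ### Isolation among stationary solutions -/

theorem exists_ae_norm_val_sub_le (n : ℕ) (x₀ : Phase n) :
    ∃ C : ℝ, 0 < C ∧ ∀ x : H1 n, ∀ᵐ t : Circ,
      ‖H1.val x t - x₀‖ ≤ C * dist x (constH1 x₀) := by
  obtain ⟨C, hC, h⟩ := exists_ae_norm_val_le n
  refine ⟨C, hC, fun x => ?_⟩
  have hv : H1.val (x - constH1 x₀) = H1.val x - Lp.const 2 (volume : Measure Circ) x₀ := rfl
  filter_upwards [h (x - constH1 x₀), Lp.coeFn_sub (H1.val x) (Lp.const 2 volume x₀),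
    Lp.coeFn_const (p := 2) (μ := (volume : Measure Circ)) x₀] with t h₁ h₂ h₃
  rwa [hv, h₂, Pi.sub_apply, h₃, Function.const_apply, ← dist_eq_norm x] at h₁

/-- If the Hessian is invertible, then the trivial solutions are isolated among the stationary
ones. -/
theorem exists_stationary_isolated {n k : ℕ} {H : Phase n × Param k → ℝ} (hH : IsC20 H)
    {x₀ : Phase n} (hx₀ : ∀ l : Param k, gradX H x₀ l = 0) {l₀ : Param k}
    (hl₀ : l₀ ∉ Lambda0 (hessX H x₀)) :
    ∃ δ : ℝ, 0 < δ ∧ ∀ p ∈ solutions H, IsStationary p.1 → dist p.1 (constH1 x₀) < δ →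
      dist p.2 l₀ < δ → p.1 = constH1 x₀ := by
  obtain ⟨κ, hκ, hA⟩ := exists_norm_le_hessOp hH hl₀
  obtain ⟨δ, hδ, hr⟩ := exists_gradX_remainder_le hH x₀ l₀
    (show (0 : ℝ) < (2 * κ)⁻¹ by positivity)
  obtain ⟨C, hC, hsup⟩ := exists_ae_norm_val_sub_le n x₀
  -- By the Sobolev bound, `H¹`-distance below `δ / C` forces values within `δ` of `x₀`.
  refine ⟨min δ (δ / C), by positivity, ?_⟩
  rintro ⟨x, l⟩ hp ⟨c, hc⟩ hx hl
  change x = constH1 c at hc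
  change dist x _ < _ at hx
  change dist l _ < _ at hl
  change x = _
  subst hc
  have hae := hsup (constH1 c)
  have hsol : ∀ᵐ t : Circ, H1.dot (constH1 c) t = JOp n (gradX H (H1.val (constH1 c) t) l) := hp
  have hconst : ∀ᵐ t : Circ, H1.val (constH1 c) t = c :=
    Lp.coeFn_const (p := 2) (μ := (volume : Measure Circ)) c
  have hzero : ∀ᵐ t : Circ, H1.dot (constH1 c) t = 0 := Lp.coeFn_zero _ _ _
  obtain ⟨t, h₁, h₂, h₃, h₄⟩ := (hae.and (hsol.and (hconst.and hzero))).exists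
  rw [h₃] at h₁ h₂
  rw [h₄] at h₂
  have hg := eq_zero_of_JOp_eq_zero h₂.symm
  have hcδ : c ∈ Metric.ball x₀ δ := by
    rw [mem_ball_iff_norm]
    refine h₁.trans_lt ?_
    rw [mul_comm, ← lt_div_iff₀ hC]
    exact hx.trans_le (min_le_right _ _)
  have hb := hr l (hl.trans_le (min_le_left _ _)) c hcδ x₀ (Metric.mem_ball_self hδ)
  rw [hg, hx₀, sub_zero, zero_sub, norm_neg] at hb
  -- Both gradients vanish, so the remainder is `A (c - x₀)`; hence `‖c - x₀‖` is at most half of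
  -- itself.
  have hlow := (hA (c - x₀)).trans (mul_le_mul_of_nonneg_left hb hκ.le)
  have heq : κ * ((2 * κ)⁻¹ * ‖c - x₀‖) = ‖c - x₀‖ / 2 := by field_simp
  rw [heq] at hlow
  have : ‖c - x₀‖ = 0 := le_antisymm (by linarith) (norm_nonneg _)
  rw [sub_eq_zero.1 (norm_eq_zero.1 this)]

/-! ### Nearby `j`-solutions are stationary -/

theorem cosCoeff_const {n : ℕ} {m : ℤ} (hm : m ≠ 0) (c : Phase n) :
    cosCoeff m (Lp.const 2 (volume : Measure Circ) c) = 0 := by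
  rw [cosCoeff, weightedInt_const, integral_cosC hm, zero_smul]

theorem sinCoeff_const {n : ℕ} {m : ℤ} (hm : m ≠ 0) (c : Phase n) :
    sinCoeff m (Lp.const 2 (volume : Measure Circ) c) = 0 := by
  rw [sinCoeff, weightedInt_const, integral_sinC hm, zero_smul]

theorem cosCoeff_zero_const {n : ℕ} (c : Phase n) :
    cosCoeff 0 (Lp.const 2 (volume : Measure Circ) c) = (2 * Real.pi) • c := by
  rw [cosCoeff, weightedInt_const]
  simp [cosC, AddCircle.measure_univ, Measure.real, Real.pi_pos.le]

theorem sinCoeff_zero {n : ℕ} (u : L2 n) : sinCoeff 0 u = 0 := by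
  simp [sinCoeff, weightedInt_apply, sinC]

/-- The term `m = 0` of Parseval bounds the mean value, as the total mass `2π` is at least `1`. -/
theorem norm_cosCoeff_zero_le {n : ℕ} (u : L2 n) : ‖(2 * Real.pi)⁻¹ • cosCoeff 0 u‖ ≤ ‖u‖ := by
  have h := le_hasSum (hasSum_energy u) 0 fun m _ => energy_nonneg m u
  rw [energy, sinCoeff_zero, norm_zero] at h
  have hpi : 1 ≤ 2 * Real.pi := by linarith [Real.pi_gt_three]
  have hpos : 0 < 2 * Real.pi := Real.two_pi_pos
  rw [norm_smul, norm_inv, Real.norm_of_nonneg hpos.le, inv_mul_le_iff₀ hpos]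
  refine abs_le_of_sq_le_sq' ?_ (by positivity) |>.2
  rw [mul_pow]
  have := mul_le_mul_of_nonneg_right hpi (mul_nonneg hpos.le (sq_nonneg ‖u‖))
  nlinarith

/-- Invariance under translation by `2π / j` leaves only harmonics with `cos (2πm / j) = 1`, that
is, `j ∣ m`. -/
theorem coeff_eq_zero_of_KK_le {n j : ℕ} (hj : 1 ≤ j) {x : H1 n} (hx : KK j ≤ isotropy x) {m : ℤ}
    (hm : ¬ (j : ℤ) ∣ m) : cosCoeff m (H1.val x) = 0 ∧ sinCoeff m (H1.val x) = 0 := by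
  have hj0 : (j : ℝ) ≠ 0 := by positivity
  have ha : ((2 * Real.pi / j : ℝ) : Circ) ∈ KK j := by
    change j • ((2 * Real.pi / j : ℝ) : Circ) = 0
    rw [← AddCircle.coe_nsmul, nsmul_eq_mul, mul_div_cancel₀ _ hj0, AddCircle.coe_period]
  refine coeff_eq_zero_of_shift (H1.val x) (2 * Real.pi / j) (hx ha) fun h => hm ?_
  obtain ⟨q, hq⟩ := (Real.cos_eq_one_iff _).1 h
  refine ⟨q, ?_⟩
  have h₁ : (q * j : ℝ) * (2 * Real.pi) = m * (2 * Real.pi) := by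
    rw [mul_right_comm, hq]
    field_simp
  have h₂ := mul_right_cancel₀ Real.two_pi_pos.ne' h₁
  rw [mul_comm]
  exact_mod_cast h₂.symm

/-- If no index divisible by `j` is resonant, then all `j`-solutions close to the trivial one are
stationary. -/
theorem exists_jSolutions_stationary {n k : ℕ} {H : Phase n × Param k → ℝ} (hH : IsC20 H)
    (x₀ : Phase n) {l₀ : Param k} {j : ℕ} (hj : 1 ≤ j)
    (hl₀ : ∀ l : ℕ, 1 ≤ l → l₀ ∉ LambdaJ (l * j) (hessX H x₀)) :
    ∃ δ : ℝ, 0 < δ ∧ ∀ p ∈ jSolutions H j, dist p.1 (constH1 x₀) < δ →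
      dist p.2 l₀ < δ → IsStationary p.1 := by
  set A := hessOp H x₀ l₀
  obtain ⟨κ, hκ, hlow⟩ := exists_harmonic_lower_bound (JOp n ∘L A)
    {m : ℤ | m ≠ 0 ∧ (j : ℤ) ∣ m} (by
      rintro m ⟨hm0, hm⟩ c s h₁ h₂
      refine harmonic_eq_zero hH (fun hdet => ?_) h₁ h₂
      obtain ⟨q, hq⟩ := Int.natCast_dvd.1 hm
      refine hl₀ q (Nat.one_le_iff_ne_zero.2 ?_) ?_
      · rintro rfl
        exact hm0 (Int.natAbs_eq_zero.1 (by simpa using hq))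
      · rw [mul_comm, ← hq]
        exact hdet)
  -- After multiplication by `J` the remainder keeps the factor `√κ / 2`, whose square `κ / 4` lies
  -- below `κ`. The `+ 1` avoids division by zero when `n = 0`.
  set ε : ℝ := Real.sqrt κ / 2 / (‖JOp n‖ + 1)
  have hε : 0 < ε := by positivity
  obtain ⟨δ, hδ, hr⟩ := exists_gradX_remainder_le hH x₀ l₀ hε
  obtain ⟨C, hC, hsup⟩ := exists_ae_norm_val_sub_le n x₀
  refine ⟨min δ (δ / C), by positivity, ?_⟩
  rintro ⟨x, l⟩ ⟨hsol, hiso⟩ hx hl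
  change dist x _ < _ at hx
  change dist l _ < _ at hl
  replace hl : l ∈ Metric.ball l₀ δ := hl.trans_le (min_le_left _ _)
  replace hsol : ∀ᵐ t : Circ, H1.dot x t = JOp n (gradX H (H1.val x t) l) := hsol
  -- The mean value of `x`: subtracting it kills the harmonic `m = 0`, for which no lower bound is
  -- available.
  set c : Phase n := (2 * Real.pi)⁻¹ • cosCoeff 0 (H1.val x) with hc
  have hcx₀ : c ∈ Metric.ball x₀ δ := by
    have h₁ : c - x₀ = (2 * Real.pi)⁻¹ • cosCoeff 0 (H1.val (x - constH1 x₀)) := by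
      have hv : H1.val (x - constH1 x₀) = H1.val x - Lp.const 2 (volume : Measure Circ) x₀ := rfl
      rw [hv, map_sub, cosCoeff_zero_const, smul_sub, inv_smul_smul₀ Real.two_pi_pos.ne']
    rw [mem_ball_iff_norm, h₁]
    refine (norm_cosCoeff_zero_le _).trans_lt (lt_of_le_of_lt ?_ (hx.trans_le (min_le_left _ _)))
    rw [dist_eq_norm]
    refine abs_le_of_sq_le_sq' ?_ (by positivity) |>.2
    rw [H1.norm_sq_eq]
    exact le_add_of_nonneg_right (sq_nonneg _)
  set y : H1 n := x - constH1 c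
  have hyval : H1.val y = H1.val x - Lp.const 2 (volume : Measure Circ) c := rfl
  have hydot : H1.dot y = H1.dot x := sub_zero _
  set R : L2 n := H1.dot y - Lp.const 2 (volume : Measure Circ) (JOp n (gradX H c l)) -
    (JOp n ∘L A).compLp (H1.val y) with hR
  have hRy : ‖R‖ ≤ (Real.sqrt κ / 2) * ‖H1.val y‖ := by
    refine Lp.norm_le_mul_norm_of_ae_le_mul ?_
    filter_upwards [hsol, hsup x, Lp.coeFn_sub (H1.val x) (Lp.const 2 volume c),
      Lp.coeFn_const (p := 2) (μ := (volume : Measure Circ)) c,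
      Lp.coeFn_const (p := 2) (μ := (volume : Measure Circ)) (JOp n (gradX H c l)),
      Lp.coeFn_sub (H1.dot y - Lp.const 2 (volume : Measure Circ) (JOp n (gradX H c l)))
        ((JOp n ∘L A).compLp (H1.val y)),
      Lp.coeFn_sub (H1.dot y) (Lp.const 2 (volume : Measure Circ) (JOp n (gradX H c l))),
      (JOp n ∘L A).coeFn_compLp (H1.val y)] with t t₁ t₂ t₃ t₄ t₅ t₆ t₇ t₈
    have hyt : H1.val y t = H1.val x t - c := by
      rw [hyval, t₃, Pi.sub_apply, t₄, Function.const_apply]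
    have hRt : R t = JOp n (gradX H (H1.val x t) l - gradX H c l - A (H1.val x t - c)) := by
      rw [hR, t₆, Pi.sub_apply, t₇, Pi.sub_apply, t₅, t₈, hydot, t₁, hyt, map_sub (JOp n),
        map_sub (JOp n)]
      rfl
    have hxt : H1.val x t ∈ Metric.ball x₀ δ := by
      rw [mem_ball_iff_norm]
      refine t₂.trans_lt ?_
      rw [mul_comm, ← lt_div_iff₀ hC]
      exact hx.trans_le (min_le_right _ _)
    rw [hRt, hyt]
    refine ((JOp n).le_opNorm _).trans ?_
    calc ‖JOp n‖ * ‖gradX H (H1.val x t) l - gradX H c l - A (H1.val x t - c)‖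
        ≤ (‖JOp n‖ + 1) * (ε * ‖H1.val x t - c‖) := by
          gcongr
          · linarith
          · exact hr l hl _ hxt c hcx₀
      _ = Real.sqrt κ / 2 * ‖H1.val x t - c‖ := by
          simp only [ε]; field_simp
  have hen (m : ℤ) : κ * energy m (H1.val y) ≤ energy m R := by
    rcases eq_or_ne m 0 with rfl | hm
    · have : energy 0 (H1.val y) = 0 := by
        rw [energy, sinCoeff_zero, hyval, map_sub, cosCoeff_zero_const, hc,
          smul_inv_smul₀ Real.two_pi_pos.ne', sub_self]
        simp
      rw [this, mul_zero]
      exact energy_nonneg _ _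
    by_cases hmj : (j : ℤ) ∣ m
    · have h := hlow m ⟨hm, hmj⟩ (cosCoeff m (H1.val y)) (sinCoeff m (H1.val y))
      have hw : IsWeakDeriv (H1.val y) (H1.dot y) := y.2
      rw [← cosCoeff_weakDeriv hw, ← sinCoeff_weakDeriv hw] at h
      rw [energy, energy, hR, map_sub, map_sub, map_sub, map_sub, cosCoeff_const hm,
        sinCoeff_const hm, sub_zero, sub_zero]
      simpa only [cosCoeff, sinCoeff, weightedInt_compLp] using h
    · have h := coeff_eq_zero_of_KK_le hj hiso hmj
      have : energy m (H1.val y) = 0 := by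
        rw [energy, hyval, map_sub, map_sub, h.1, h.2, cosCoeff_const hm, sinCoeff_const hm]
        simp
      rw [this, mul_zero]
      exact energy_nonneg _ _
  have hle := hasSum_le hen ((hasSum_energy (H1.val y)).mul_left κ) (hasSum_energy R)
  have hsq : ‖R‖ ^ 2 ≤ κ / 4 * ‖H1.val y‖ ^ 2 := by
    refine (pow_le_pow_left₀ (norm_nonneg _) hRy 2).trans_eq ?_
    rw [mul_pow, div_pow, Real.sq_sqrt hκ.le]
    norm_num
  have hpi := Real.two_pi_pos
  have hval : H1.val y = 0 := by
    have h₁ : κ * ‖H1.val y‖ ^ 2 ≤ ‖R‖ ^ 2 := by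
      refine le_of_mul_le_mul_left ?_ hpi
      linarith
    have h₂ : κ * ‖H1.val y‖ ^ 2 ≤ 0 := by linarith
    by_contra hne
    have : 0 < κ * ‖H1.val y‖ ^ 2 := mul_pos hκ (pow_pos (norm_pos_iff.2 hne) 2)
    linarith
  -- The weak derivative of zero is zero, since all its harmonics vanish.
  have hdot : H1.dot y = 0 := by
    have hz (m : ℤ) : energy m (H1.dot y) = 0 := by
      rw [energy_dot, hval, energy]
      simp
    have h₀ : 2 * Real.pi * ‖H1.dot y‖ ^ 2 = 0 :=
      (hasSum_energy (H1.dot y)).unique (hasSum_zero.congr_fun hz)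
    simpa [hpi.ne', Real.pi_ne_zero] using h₀
  have hy : ‖y‖ ^ 2 = 0 := by rw [H1.norm_sq_eq, hval, hdot]; simp
  exact ⟨c, sub_eq_zero.1 (norm_eq_zero.1 (pow_eq_zero_iff two_ne_zero |>.1 hy))⟩

/-! ### From isolation to bifurcation points -/

theorem IsBifurcationPoint.exists_mem {n k : ℕ} {H : Phase n × Param k → ℝ} {x₀ : Phase n}
    {l₀ : Param k} {X : Set (H1 n × Param k)} (h : IsBifurcationPoint H x₀ l₀ X) {δ : ℝ}
    (hδ : 0 < δ) : ∃ p ∈ X, dist p.1 (constH1 x₀) < δ ∧ dist p.2 l₀ < δ := by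
  obtain ⟨p, ⟨-, hp⟩, hd⟩ :=
    ((accPt_iff_frequently.1 h.2).and_eventually (Metric.ball_mem_nhds _ hδ)).exists
  exact ⟨p, hp, max_lt_iff.1 hd⟩

theorem KK_one_le {n : ℕ} (x : H1 n) : KK 1 ≤ isotropy x := by
  intro a ha
  have : 1 • a = 0 := ha
  rw [one_nsmul] at this
  rw [this]
  exact zero_mem _

end HamBif

end

theorem mainTheorem10 (n k : ℕ)
    (H : HamBif.Phase n × HamBif.Param k → ℝ) (hH : HamBif.IsC20 H)
    (x₀ : HamBif.Phase n) (hx₀ : ∀ l : HamBif.Param k, HamBif.gradX H x₀ l = 0)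
    (l₀ : HamBif.Param k) :
    (HamBif.IsBifurcationPoint H x₀ l₀ (HamBif.nontrivialSolutions H x₀) →
      l₀ ∈ HamBif.Lambda0 (HamBif.hessX H x₀) ∪ HamBif.Lambda (HamBif.hessX H x₀)) ∧
    (HamBif.IsBifurcationPoint H x₀ l₀
        {p | p ∈ HamBif.nontrivialSolutions H x₀ ∧ HamBif.IsStationary p.1} →
      l₀ ∈ HamBif.Lambda0 (HamBif.hessX H x₀)) ∧
    (∀ j : ℕ, 1 ≤ j →
      HamBif.IsBifurcationPoint H x₀ l₀
        {p | p ∈ HamBif.jSolutions H j ∧ ¬ HamBif.IsStationary p.1} →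
      l₀ ∈ ⋃ l : ℕ, ⋃ _ : 1 ≤ l, HamBif.LambdaJ (l * j) (HamBif.hessX H x₀)) := by
  refine ⟨fun h => ?_, fun h => ?_, fun j hj h => ?_⟩
  · by_contra hl₀
    rw [Set.mem_union, not_or] at hl₀
    obtain ⟨δ₁, hδ₁, h₁⟩ := HamBif.exists_stationary_isolated hH hx₀ hl₀.1
    -- With `j = 1` the symmetry condition is empty, so this covers every solution.
    obtain ⟨δ₂, hδ₂, h₂⟩ := HamBif.exists_jSolutions_stationary hH x₀ le_rfl (l₀ := l₀)
      fun l hl hmem => hl₀.2 (Set.mem_iUnion₂.2 ⟨l, hl, by rwa [mul_one] at hmem⟩)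
    obtain ⟨p, hp, hp₁, hp₂⟩ := h.exists_mem (lt_min hδ₁ hδ₂)
    rw [lt_min_iff] at hp₁ hp₂
    exact hp.2 (h₁ p hp.1 (h₂ p ⟨hp.1, HamBif.KK_one_le p.1⟩ hp₁.2 hp₂.2) hp₁.1 hp₂.1)
  · by_contra hl₀
    obtain ⟨δ, hδ, h₁⟩ := HamBif.exists_stationary_isolated hH hx₀ hl₀
    obtain ⟨p, hp, hp₁, hp₂⟩ := h.exists_mem hδ
    exact hp.1.2 (h₁ p hp.1.1 hp.2 hp₁ hp₂)
  · by_contra hl₀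
    obtain ⟨δ, hδ, h₁⟩ := HamBif.exists_jSolutions_stationary hH x₀ hj (l₀ := l₀)
      fun l hl hmem => hl₀ (Set.mem_iUnion₂.2 ⟨l, hl, hmem⟩)
    obtain ⟨p, hp, hp₁, hp₂⟩ := h.exists_mem hδ
    exact hp.2 (h₁ p hp.1 hp₁ hp₂)
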